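/- Let $1\le p<\infty$. There is a constant $C_p$ depending only on $p$ such that the following holds. Let $\mathbb{T}=\mathbb{R}/2\pi\mathbb{Z}$ with its usual arc length distance $|x-y|$, let $\mu$ be a finite (nonnegative) Borel measure on $\mathbb{T}$ that is absolutely continuous with respect to Lebesgue measure, and let the perturbation $d\mu$ be a finite signed Borel measure on $\mathbb{T}$ with total mass zero such that $\mu+d\mu$ is again a nonnegative measure. Then $$W_p(\mu,\mu+d\mu)\le C_p\left(\sum_{k=1}^{\infty}\frac{|\widehat{d\mu}(k)|^2}{k^{2p-2}}\right)^{\frac1{2p}},$$ where the right-hand side is $+\infty$ if the series diverges, $\widehat{d\mu}(k)=\frac1{2\pi}\int_{\mathbb{T}}e^{-ikx}\,d\mu(x)$ denotes the $k$-th Fourier coefficient of the perturbation, and $$W_p(\mu,\nu)=\left(\inf_{\gamma}\int_{\mathbb{T}\times\mathbb{T}}|x-y|^p\,d\gamma(x,y)\right)^{1/p},$$ the infimum being over all measures $\gamma$ on $\mathbb{T}\times\mathbb{T}$ with marginals $\mu$ and $\nu$. -/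

import Mathlib

open MeasureTheory
open scoped Real NNReal ENNReal

noncomputable section

namespace TorusTransport

/-- The period of the torus is positive. -/
instance instFactTwoPiPos : Fact (0 < 2 * π) := ⟨Real.two_pi_pos⟩

/-- The one-dimensional torus `ℝ / 2πℤ`. Its distance is the arc length distance, and its
`volume` is Lebesgue measure, of total mass `2π`. -/
abbrev Torus : Type := AddCircle (2 * π)

/-- The set of couplings of `μ` and `ν`: the measures on the product whose marginals are
`μ` and `ν`. -/
def couplings {X : Type*} [MeasurableSpace X] (μ ν : Measure X) : Set (Measure (X × X)) :=
  {γ | γ.map Prod.fst = μ ∧ γ.map Prod.snd = ν}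

/-- The `p`-Wasserstein distance
`W_p(μ, ν) = (inf_γ ∫∫ d(x, y) ^ p dγ(x, y)) ^ (1 / p)`, with the infimum taken over all
couplings `γ` of `μ` and `ν`; it is `∞` if there is no coupling. -/
def wasserstein {X : Type*} [PseudoEMetricSpace X] [MeasurableSpace X] (p : ℝ)
    (μ ν : Measure X) : ℝ≥0∞ :=
  (⨅ γ ∈ couplings μ ν, ∫⁻ z, edist z.1 z.2 ^ p ∂γ) ^ (1 / p)

/-- The `k`-th Fourier coefficient `(1 / 2π) ∫ e ^ (-ikx) dσ(x)` of a finite signed measure on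
the torus. -/
def fourierCoeffMeasure (σ : SignedMeasure Torus) (k : ℤ) : ℂ :=
  (1 / (2 * π) : ℝ) • σ.integral (fun x : Torus => (fourier (-k) x : ℂ))
    (ContinuousLinearMap.lsmul ℝ ℝ).flip

end TorusTransport

end

namespace TorusTransport

section Duality

open scoped CompactlySupported

variable {X : Type*} [MetricSpace X] [CompactSpace X] [MeasurableSpace X] [BorelSpace X]

/-- The function `(x, y) ↦ φ x + ψ y` on the product, linearly in the pair `(φ, ψ)`. -/
noncomputable def sumFunction (X : Type*) [TopologicalSpace X] :
    C(X, ℝ) × C(X, ℝ) →ₗ[ℝ] C(X × X, ℝ) where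
  toFun q := q.1.comp .fst + q.2.comp .snd
  map_add' q r := by ext z; simp; ring
  map_smul' a q := by ext z; simp

theorem sumFunction_apply {X : Type*} [TopologicalSpace X] (q : C(X, ℝ) × C(X, ℝ)) (z : X × X) :
    sumFunction X q z = q.1 z.1 + q.2 z.2 := rfl

theorem integrable_continuousMap {Y : Type*} [TopologicalSpace Y] [CompactSpace Y]
    [MeasurableSpace Y] [OpensMeasurableSpace Y] (μ : Measure Y) [IsFiniteMeasure μ] (f : C(Y, ℝ)) :
    Integrable f μ := by
  have := (BoundedContinuousFunction.mkOfCompact f).integrable μ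
  exact this

theorem integral_sumFunction (μ ν : Measure X) [IsFiniteMeasure μ] [IsFiniteMeasure ν]
    (h : μ.real Set.univ = ν.real Set.univ) (q : C(X, ℝ) × C(X, ℝ)) :
    (μ.real Set.univ)⁻¹ * ∫ z, sumFunction X q z ∂(μ.prod ν) = ∫ x, q.1 x ∂μ + ∫ y, q.2 y ∂ν := by
  by_cases h0 : μ.real Set.univ = 0
  · have hμ : μ = 0 := Measure.measure_univ_eq_zero.mp ((measureReal_eq_zero_iff).mp h0)
    have hν : ν = 0 := Measure.measure_univ_eq_zero.mp ((measureReal_eq_zero_iff).mp (h ▸ h0))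
    simp [hμ, hν]
  · simp only [sumFunction_apply]
    rw [integral_add, integral_fun_fst, integral_fun_snd, ← h]
    · simp only [smul_eq_mul]
      field_simp
    · exact (integrable_continuousMap μ q.1).comp_fst ν
    · exact (integrable_continuousMap ν q.2).comp_snd μ

/-- A linear functional on `C(Y, ℝ)`, for compact `Y`, which is nonnegative on nonnegative functions
is the integral against a finite measure. -/
theorem exists_measure_of_nonneg {Y : Type*} [TopologicalSpace Y] [T2Space Y] [CompactSpace Y]
    [MeasurableSpace Y] [BorelSpace Y] (Λ : C(Y, ℝ) →ₗ[ℝ] ℝ) (hΛ : ∀ u, (∀ z, 0 ≤ u z) → 0 ≤ Λ u) :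
    ∃ γ : Measure Y, IsFiniteMeasure γ ∧ ∀ u : C(Y, ℝ), ∫ z, u z ∂γ = Λ u := by
  let Λ' : C_c(Y, ℝ) →ₚ[ℝ] ℝ :=
    { toFun g := Λ g.toContinuousMap
      map_add' g g' := by
        rw [← map_add]; rfl
      map_smul' a g := by
        rw [RingHom.id_apply, ← map_smul]; rfl
      monotone' g g' hgg' := by
        have := hΛ (g'.toContinuousMap - g.toContinuousMap) fun z => by
          simpa using hgg' z
        rw [map_sub] at this
        exact sub_nonneg.mp this }
  refine ⟨RealRMK.rieszMeasure Λ', inferInstance, fun u => ?_⟩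
  exact RealRMK.integral_rieszMeasure Λ' ⟨u, HasCompactSupport.of_compactSpace _⟩

theorem ext_of_integral_continuousMap_eq {X : Type*} [MetricSpace X] [MeasurableSpace X]
    [BorelSpace X] (μ ν : Measure X)
    [IsFiniteMeasure μ] [IsFiniteMeasure ν] (h : ∀ f : C(X, ℝ), ∫ x, f x ∂μ = ∫ x, f x ∂ν) :
    μ = ν :=
  ext_of_forall_integral_eq_of_IsFiniteMeasure fun f => h f.toContinuousMap

/-- **Kantorovich duality** on a compact metric space: a bound for the dual problem bounds the
cost of some coupling. -/
theorem exists_coupling_integral_le (μ ν : Measure X) [IsFiniteMeasure μ] [IsFiniteMeasure ν]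
    (h : μ.real Set.univ = ν.real Set.univ) (c : C(X × X, ℝ)) (V : ℝ)
    (hV : ∀ φ ψ : C(X, ℝ), (∀ x y, φ x + ψ y ≤ c (x, y)) → ∫ x, φ x ∂μ + ∫ y, ψ y ∂ν ≤ V) :
    ∃ γ ∈ couplings μ ν, IsFiniteMeasure γ ∧ ∫ z, c z ∂γ ≤ V := by
  let Φ : (C(X, ℝ) × C(X, ℝ)) × ℝ →ₗ[ℝ] C(X × X, ℝ) × ℝ := (sumFunction X).prodMap LinearMap.id
  let F : C(X × X, ℝ) × ℝ →ₗ[ℝ] ℝ :=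
    { toFun w := (μ.real Set.univ)⁻¹ * ∫ z, w.1 z ∂(μ.prod ν) + w.2 * V
      map_add' w w' := by
        have := integral_add (integrable_continuousMap (μ.prod ν) w.1)
          (integrable_continuousMap (μ.prod ν) w'.1)
        simp only [Prod.fst_add, Prod.snd_add, ContinuousMap.add_apply, this]
        ring
      map_smul' a w := by
        simp only [Prod.smul_fst, Prod.smul_snd, ContinuousMap.smul_apply, smul_eq_mul,
          integral_const_mul, RingHom.id_apply]
        ring }
  have hF : ∀ q t, F (Φ (q, t)) = ∫ x, q.1 x ∂μ + ∫ y, q.2 y ∂ν + t * V := fun q t => by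
    rw [← integral_sumFunction μ ν h q]; rfl
  let s : PointedCone ℝ (C(X × X, ℝ) × ℝ) :=
    { carrier := {w | 0 ≤ w.2 ∧ ∀ z, 0 ≤ w.1 z + w.2 * c z}
      add_mem' := by
        rintro w w' ⟨h1, h2⟩ ⟨h3, h4⟩
        refine ⟨add_nonneg h1 h3, fun z => ?_⟩
        have := add_nonneg (h2 z) (h4 z)
        simp only [Prod.fst_add, Prod.snd_add, ContinuousMap.add_apply]
        linarith
      zero_mem' := by simp
      smul_mem' := by
        rintro ⟨a, ha⟩ w ⟨h1, h2⟩
        refine ⟨mul_nonneg ha h1, fun z => ?_⟩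
        have := mul_nonneg ha (h2 z)
        change 0 ≤ a * w.1 z + a * w.2 * c z
        linarith }
  obtain ⟨g, hg, hgs⟩ := riesz_extension s ⟨Φ.range, F.domRestrict Φ.range⟩ (by
    rintro ⟨_, ⟨⟨⟨φ, ψ⟩, t⟩, rfl⟩⟩ ⟨ht, hz⟩
    change 0 ≤ F (Φ ((φ, ψ), t))
    rw [hF]
    change 0 ≤ t at ht
    change ∀ z : X × X, 0 ≤ φ z.1 + ψ z.2 + t * c z at hz
    rcases ht.eq_or_lt with rfl | ht
    · rw [← integral_sumFunction μ ν h (φ, ψ), zero_mul, add_zero]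
      refine mul_nonneg (by positivity) (integral_nonneg fun z => ?_)
      simpa [sumFunction_apply] using hz z
    · have := hV (-(t⁻¹ • φ)) (-(t⁻¹ • ψ)) fun x y => by
        have := mul_nonneg (inv_pos.mpr ht).le (hz (x, y))
        simp only [ContinuousMap.neg_apply, ContinuousMap.smul_apply, smul_eq_mul]
        have e : t⁻¹ * (φ x + ψ y + t * c (x, y)) = t⁻¹ * φ x + t⁻¹ * ψ y + c (x, y) := by
          field_simp
        linarith
      simp only [ContinuousMap.neg_apply, ContinuousMap.smul_apply, smul_eq_mul, integral_neg,
        integral_const_mul] at this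
      have := mul_le_mul_of_nonneg_left this ht.le
      have e : t * (-(t⁻¹ * ∫ x, φ x ∂μ) + -(t⁻¹ * ∫ x, ψ x ∂ν)) =
          -(∫ x, φ x ∂μ + ∫ x, ψ x ∂ν) := by field_simp; ring
      simp only
      linarith) (by
    rintro ⟨u, t⟩
    refine ⟨⟨Φ ((ContinuousMap.const X ‖u‖, 0), -t), ⟨_, rfl⟩⟩, ?_, fun z => ?_⟩
    · change 0 ≤ -t + t
      simp
    · change 0 ≤ ‖u‖ + 0 + u z + (-t + t) * c z
      have := abs_le.mp (u.norm_coe_le_norm z)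
      linarith [this.1])
  have hgF : ∀ q t, g (Φ (q, t)) = ∫ x, q.1 x ∂μ + ∫ y, q.2 y ∂ν + t * V := fun q t => by
    rw [← hF]
    exact hg ⟨Φ (q, t), ⟨_, rfl⟩⟩
  obtain ⟨γ, hγ, hγΛ⟩ := exists_measure_of_nonneg (g ∘ₗ LinearMap.inl ℝ C(X × X, ℝ) ℝ) fun u hu =>
    hgs _ ⟨le_rfl, fun z => by simpa using hu z⟩
  refine ⟨γ, ⟨?_, ?_⟩, hγ, ?_⟩
  · refine ext_of_integral_continuousMap_eq _ _ fun f => ?_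
    rw [integral_map measurable_fst.aemeasurable
      (map_continuous f).measurable.aestronglyMeasurable]
    have := hgF (f, 0) 0
    simp only [ContinuousMap.zero_apply, integral_zero, zero_mul, add_zero] at this
    rw [← this]
    refine (hγΛ (f.comp .fst)).trans ?_
    refine congrArg g (Prod.ext (ContinuousMap.ext fun z => ?_) rfl)
    simp [Φ, sumFunction_apply]
  · refine ext_of_integral_continuousMap_eq _ _ fun f => ?_
    rw [integral_map measurable_snd.aemeasurable
      (map_continuous f).measurable.aestronglyMeasurable]
    have := hgF (0, f) 0
    simp only [ContinuousMap.zero_apply, integral_zero, zero_mul, add_zero, zero_add] at this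
    rw [← this]
    refine (hγΛ (f.comp .snd)).trans ?_
    refine congrArg g (Prod.ext (ContinuousMap.ext fun z => ?_) rfl)
    simp [Φ, sumFunction_apply]
  · rw [hγΛ c]
    have h1 := hgF 0 1
    have h2 := hgs (-c, 1) ⟨zero_le_one, fun z => by simp⟩
    have e : ((-c, 1) : C(X × X, ℝ) × ℝ) = Φ (0, 1) - LinearMap.inl ℝ C(X × X, ℝ) ℝ c := by
      ext z <;> simp [Φ]
    rw [e, map_sub, h1] at h2
    simpa using h2

end Duality

section SmoothStep

open scoped ContDiff

/-- If a smooth function agrees with two functions with bounded derivative to the left and to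
the right of a point, then the same bound holds for its derivative. -/
theorem abs_iteratedDeriv_le_of_glue {f g₁ g₂ : ℝ → ℝ} {a K : ℝ} {m : ℕ} (hf : ContDiff ℝ m f)
    (h₁ : ∀ t < a, f t = g₁ t) (h₂ : ∀ t > a, f t = g₂ t)
    (hK₁ : ∀ t, |iteratedDeriv m g₁ t| ≤ K) (hK₂ : ∀ t, |iteratedDeriv m g₂ t| ≤ K) (t : ℝ) :
    |iteratedDeriv m f t| ≤ K := by
  have hcl : IsClosed {t | |iteratedDeriv m f t| ≤ K} :=
    isClosed_le (hf.continuous_iteratedDeriv m le_rfl).abs continuous_const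
  have hsub : ({a}ᶜ : Set ℝ) ⊆ {t | |iteratedDeriv m f t| ≤ K} := by
    intro t ht
    rcases lt_or_gt_of_ne ht with h | h
    · simpa [Set.EqOn.iteratedDeriv_of_isOpen (fun s hs => h₁ s hs) isOpen_Iio m h] using hK₁ t
    · simpa [Set.EqOn.iteratedDeriv_of_isOpen (fun s hs => h₂ s hs) isOpen_Ioi m h] using hK₂ t
  exact hcl.closure_subset_iff.mpr hsub ((dense_compl_singleton a).closure_eq ▸ Set.mem_univ t)

theorem exists_bound_iteratedDeriv_smoothTransition {m : ℕ} (hm : 1 ≤ m) :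
    ∃ B, ∀ t, |iteratedDeriv m Real.smoothTransition t| ≤ B := by
  have hc : Continuous (iteratedDeriv m Real.smoothTransition) :=
    (Real.smoothTransition.contDiff (n := m)).continuous_iteratedDeriv m le_rfl
  obtain ⟨B, hB⟩ := isCompact_Icc.exists_bound_of_continuousOn (s := Set.Icc (0 : ℝ) 1)
    hc.continuousOn
  refine ⟨B, fun t => ?_⟩
  have hB0 : 0 ≤ B := (norm_nonneg _).trans (hB 0 (by simp))
  have hm0 : m ≠ 0 := by omega
  by_cases h0 : t < 0
  · rw [Set.EqOn.iteratedDeriv_of_isOpen (f := Real.smoothTransition) (g := fun _ => 0)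
      (s := Set.Iio 0) (fun s hs => Real.smoothTransition.zero_of_nonpos (le_of_lt hs))
      isOpen_Iio m h0]
    simpa using hB0
  by_cases h1 : 1 < t
  · rw [Set.EqOn.iteratedDeriv_of_isOpen (f := Real.smoothTransition) (g := fun _ => 1)
      (s := Set.Ioi 1) (fun s hs => Real.smoothTransition.one_of_one_le (le_of_lt hs))
      isOpen_Ioi m h1]
    simpa [iteratedDeriv_const, hm0] using hB0
  exact hB t ⟨not_lt.mp h0, not_lt.mp h1⟩

/-- The smooth step from the value `c` at `x` to the value `d` at `x + ℓ`. -/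
noncomputable def smoothStep (x ℓ c d t : ℝ) : ℝ :=
  c + (d - c) * Real.smoothTransition (ℓ⁻¹ * (t - x))

theorem smoothStep_contDiff (x ℓ c d : ℝ) {n : ℕ∞} : ContDiff ℝ n (smoothStep x ℓ c d) :=
  contDiff_const.add (contDiff_const.mul (Real.smoothTransition.contDiff.comp
    (contDiff_const.mul (contDiff_id.sub contDiff_const))))

theorem smoothStep_of_le {x ℓ c d t : ℝ} (hℓ : 0 < ℓ) (ht : t ≤ x) : smoothStep x ℓ c d t = c := by
  rw [smoothStep, Real.smoothTransition.zero_of_nonpos, mul_zero, add_zero]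
  exact mul_nonpos_of_nonneg_of_nonpos (inv_pos.mpr hℓ).le (by linarith)

theorem smoothStep_of_ge {x ℓ c d t : ℝ} (hℓ : 0 < ℓ) (ht : x + ℓ ≤ t) :
    smoothStep x ℓ c d t = d := by
  rw [smoothStep, Real.smoothTransition.one_of_one_le, mul_one, add_sub_cancel]
  rw [← div_eq_inv_mul, one_le_div hℓ]
  linarith

theorem le_smoothStep {x ℓ c d t b : ℝ} (hc : b ≤ c) (hd : b ≤ d) : b ≤ smoothStep x ℓ c d t := by
  have h0 := Real.smoothTransition.nonneg (ℓ⁻¹ * (t - x))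
  have h1 := Real.smoothTransition.le_one (ℓ⁻¹ * (t - x))
  rw [smoothStep]
  nlinarith [mul_nonneg (sub_nonneg.mpr hc) (sub_nonneg.mpr h1), mul_nonneg (sub_nonneg.mpr hd) h0]

theorem smoothStep_le {x ℓ c d t b : ℝ} (hc : c ≤ b) (hd : d ≤ b) : smoothStep x ℓ c d t ≤ b := by
  have h0 := Real.smoothTransition.nonneg (ℓ⁻¹ * (t - x))
  have h1 := Real.smoothTransition.le_one (ℓ⁻¹ * (t - x))
  rw [smoothStep]
  nlinarith [mul_nonneg (sub_nonneg.mpr hc) (sub_nonneg.mpr h1), mul_nonneg (sub_nonneg.mpr hd) h0]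

theorem iteratedDeriv_smoothStep {m : ℕ} (hm : 1 ≤ m) (x ℓ c d t : ℝ) :
    iteratedDeriv m (smoothStep x ℓ c d) t =
      (d - c) * ((ℓ⁻¹) ^ m * iteratedDeriv m Real.smoothTransition (ℓ⁻¹ * (t - x))) := by
  have h1 : smoothStep x ℓ c d = fun t => c + (d - c) * (fun s => Real.smoothTransition (ℓ⁻¹ * s))
    (t - x) := rfl
  rw [h1, iteratedDeriv_const_add hm, iteratedDeriv_const_mul_field,
    iteratedDeriv_comp_sub_const m (fun s => Real.smoothTransition (ℓ⁻¹ * s)),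
    iteratedDeriv_comp_const_mul Real.smoothTransition.contDiff]

end SmoothStep

section Insertion

open scoped ContDiff

/-- `F₁` lies below `F₂` on the closed interval of radius `r` around `x`, uniformly. -/
def SeparatedOn (F₁ F₂ : ℝ → ℝ) (x r : ℝ) : Prop :=
  ∀ y z, |y - x| ≤ r → |z - x| ≤ r → F₁ y ≤ F₂ z

/-- `R` is a `1`-Lipschitz radius on which `F₁` and `F₂` are separated, whereas they are not
separated at four times the radius. -/
structure IsSeparationScale (F₁ F₂ R : ℝ → ℝ) : Prop where
  separated : ∀ x, SeparatedOn F₁ F₂ x (R x)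
  not_separated : ∀ x, ¬ SeparatedOn F₁ F₂ x (4 * R x)
  lipschitz : ∀ x y, R x ≤ R y + |x - y|

theorem exists_separationScale {F₁ F₂ : ℝ → ℝ} {T δ : ℝ} (hT : 0 < T) (h₁ : F₁.Periodic T)
    (h₂ : F₂.Periodic T) (hδ : 0 < δ) (hsep : ∀ y z, |y - z| ≤ δ → F₁ y ≤ F₂ z) {a b : ℝ}
    (hab : F₂ b < F₁ a) :
    ∃ R : ℝ → ℝ, IsSeparationScale F₁ F₂ R ∧ R.Periodic T ∧ ∀ x, δ / 4 ≤ R x ∧ R x ≤ T / 2 := by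
  let S : ℝ → Set ℝ := fun x => {r | SeparatedOn F₁ F₂ x r}
  have hdown : ∀ x r s, r ∈ S x → s ≤ r → s ∈ S x := fun x r s hr hs y z hy hz =>
    hr y z (hy.trans hs) (hz.trans hs)
  have hmem : ∀ x, δ / 2 ∈ S x := fun x y z hy hz => hsep y z (by
    rw [abs_le] at *
    constructor <;> linarith)
  have hle : ∀ x, ∀ r ∈ S x, r ≤ T := by
    intro x r hr
    by_contra! h
    obtain ⟨a', ha', e₁⟩ := h₁.exists_mem_Ico hT a x
    obtain ⟨b', hb', e₂⟩ := h₂.exists_mem_Ico hT b x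
    have := hr a' b' (by rw [abs_le]; constructor <;> linarith [ha'.1, ha'.2])
      (by rw [abs_le]; constructor <;> linarith [hb'.1, hb'.2])
    rw [← e₁, ← e₂] at this
    linarith
  have hbdd : ∀ x, BddAbove (S x) := fun x => ⟨T, hle x⟩
  have hpos : ∀ x, δ / 2 ≤ sSup (S x) := fun x => le_csSup (hbdd x) (hmem x)
  refine ⟨fun x => sSup (S x) / 2, ⟨fun x => ?_, fun x h => ?_, fun x y => ?_⟩, fun x => ?_,
    fun x => ⟨by linarith [hpos x], ?_⟩⟩
  · obtain ⟨r, hr, hlt⟩ := exists_lt_of_lt_csSup ⟨_, hmem x⟩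
      (show sSup (S x) / 2 < sSup (S x) by linarith [hpos x])
    exact hdown x r _ hr hlt.le
  · have := le_csSup (hbdd x) h
    linarith [hpos x]
  · have : sSup (S x) ≤ sSup (S y) + |x - y| := by
      refine csSup_le ⟨_, hmem x⟩ fun r hr => ?_
      have : r - |x - y| ∈ S y := fun u v hu hv => by
        have t₁ := abs_sub_le u y x
        have t₂ := abs_sub_le v y x
        rw [abs_sub_comm y x] at t₁ t₂
        exact hr u v (by linarith) (by linarith)
      linarith [le_csSup (hbdd y) this]
    linarith [abs_nonneg (x - y)]
  · have : S (x + T) = S x := by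
      ext r
      refine ⟨fun hr y z hy hz => ?_, fun hr y z hy hz => ?_⟩
      · rw [← h₁ y, ← h₂ z]
        exact hr _ _ (by simpa using hy) (by simpa using hz)
      · rw [← h₁.sub_eq y, ← h₂.sub_eq z]
        exact hr _ _ (by rwa [sub_sub, add_comm T x]) (by rwa [sub_sub, add_comm T x])
    simp only [this]
  · linarith [csSup_le ⟨_, hmem x⟩ (hle x)]

/-- A value between `F₁` and `F₂` near `x` which is not much larger than a nearby value of
`F₁` and not much smaller than a nearby value of `F₂`. -/
structure IsLocalLevel (F₁ F₂ R : ℝ → ℝ) (p x c : ℝ) : Prop where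
  between : ∀ y, |y - x| ≤ R x → F₁ y ≤ c ∧ c ≤ F₂ y
  le_upper : ∃ a, |a - x| ≤ 4 * R x ∧ c ≤ F₁ a + (5 * R x) ^ p
  lower_le : ∃ b, |b - x| ≤ 4 * R x ∧ F₂ b ≤ c + (5 * R x) ^ p

theorem exists_isLocalLevel {F₁ F₂ R : ℝ → ℝ} {p : ℝ} (hp : 0 ≤ p)
    (hF : ∀ x y, F₁ x - F₂ y ≤ |x - y| ^ p) (hR : IsSeparationScale F₁ F₂ R) {x : ℝ}
    (hx : 0 ≤ R x) : ∃ c, IsLocalLevel F₁ F₂ R p x c := by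
  obtain ⟨a, b, ha, hb, hab⟩ : ∃ a b, |a - x| ≤ 4 * R x ∧ |b - x| ≤ 4 * R x ∧ F₂ b < F₁ a := by
    have := hR.not_separated x
    simp only [SeparatedOn] at this
    push Not at this
    obtain ⟨a, b, ha, hb, hab⟩ := this
    exact ⟨a, b, ha, hb, hab⟩
  set D := (5 * R x) ^ p
  have hD : 0 ≤ D := by positivity
  have hFD : ∀ y z, |y - x| ≤ R x → |z - x| ≤ 4 * R x → F₁ y ≤ F₂ z + D ∧ F₁ z ≤ F₂ y + D := by
    intro y z hy hz
    have hyz : |y - z| ≤ 5 * R x := by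
      rw [abs_le] at *
      constructor <;> linarith
    have h1 := (hF y z).trans (Real.rpow_le_rpow (abs_nonneg _) hyz hp)
    have h2 := (hF z y).trans (Real.rpow_le_rpow (abs_nonneg _) (abs_sub_comm y z ▸ hyz) hp)
    constructor <;> linarith
  let A : Set ℝ := insert (F₂ b - D) {t | ∃ y, |y - x| ≤ R x ∧ F₁ y = t}
  have hA : ∀ u, F₂ b - D ≤ u → (∀ y, |y - x| ≤ R x → F₁ y ≤ u) → ∀ t ∈ A, t ≤ u := by
    rintro u h1 h2 t (rfl | ⟨y, hy, rfl⟩)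
    exacts [h1, h2 y hy]
  have hAb : ∀ t ∈ A, t ≤ F₂ b + D := hA _ (by linarith) fun y hy => (hFD y b hy hb).1
  have hbdd : BddAbove A := ⟨_, hAb⟩
  have hne : A.Nonempty := ⟨_, Set.mem_insert _ _⟩
  refine ⟨sSup A, fun y hy => ⟨le_csSup hbdd (Or.inr ⟨y, hy, rfl⟩), ?_⟩, ⟨a, ha, ?_⟩, ⟨b, hb, ?_⟩⟩
  · exact csSup_le hne (hA _ (by linarith [(hFD y a hy ha).2]) fun z hz => hR.separated x z y hz hy)
  · exact (csSup_le hne hAb).trans (by linarith)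
  · linarith [le_csSup hbdd (Set.mem_insert (F₂ b - D) _)]

end Insertion

section Chain

open scoped ContDiff

theorem IsLocalLevel.abs_sub_le {F₁ F₂ R : ℝ → ℝ} {p x y c d : ℝ} (hp : 0 ≤ p)
    (hF : ∀ x y, F₁ x - F₂ y ≤ |x - y| ^ p) (hR : IsSeparationScale F₁ F₂ R)
    (hx : IsLocalLevel F₁ F₂ R p x c) (hy : IsLocalLevel F₁ F₂ R p y d) (hRx : 0 ≤ R x)
    (hRy : 0 ≤ R y) (hxy : |x - y| ≤ R x / 2) : |c - d| ≤ 3 * (11 * R x) ^ p := by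
  have hle : R y ≤ 3 / 2 * R x := by
    have := hR.lipschitz y x
    rw [abs_sub_comm] at this
    linarith
  have hD₁ : (5 * R x) ^ p ≤ (11 * R x) ^ p :=
    Real.rpow_le_rpow (by positivity) (by linarith) hp
  have hD₂ : (5 * R y) ^ p ≤ (11 * R x) ^ p :=
    Real.rpow_le_rpow (by positivity) (by linarith) hp
  have hD₃ : ∀ a b, |a - b| ≤ 11 * R x → F₁ a ≤ F₂ b + (11 * R x) ^ p := fun a b hab => by
    have := (hF a b).trans (Real.rpow_le_rpow (abs_nonneg _) hab hp)
    linarith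
  obtain ⟨a, ha, hca⟩ := hx.le_upper
  obtain ⟨b, hb, hbc⟩ := hx.lower_le
  obtain ⟨a', ha', hca'⟩ := hy.le_upper
  obtain ⟨b', hb', hbc'⟩ := hy.lower_le
  have e₁ := hD₃ a b' (by rw [abs_le] at *; constructor <;> linarith)
  have e₂ := hD₃ a' b (by rw [abs_le] at *; constructor <;> linarith)
  rw [_root_.abs_le]
  constructor <;> linarith

/-- A smooth function between `F₁` and `F₂` on `[x, y]`, constant outside that interval, with
`m`-th derivative bounded by `K`. -/
structure IsSmoothBetween (F₁ F₂ : ℝ → ℝ) (m : ℕ) (K x y c d : ℝ) (G : ℝ → ℝ) : Prop where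
  contDiff : ContDiff ℝ ∞ G
  eq_left : ∀ t ≤ x, G t = c
  eq_right : ∀ t, y ≤ t → G t = d
  between : ∀ t, x ≤ t → t ≤ y → F₁ t ≤ G t ∧ G t ≤ F₂ t
  bound : ∀ t, |iteratedDeriv m G t| ≤ K

theorem IsSmoothBetween.trans {F₁ F₂ G H : ℝ → ℝ} {m : ℕ} {K x y z c d e : ℝ}
    (hxy : x ≤ y) (hyz : y ≤ z)
    (hG : IsSmoothBetween F₁ F₂ m K x y c d G) (hH : IsSmoothBetween F₁ F₂ m K y z d e H) :
    IsSmoothBetween F₁ F₂ m K x z c e (fun t => G t + (H t - d)) := by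
  have h₁ : ∀ t ≤ y, G t + (H t - d) = G t := fun t ht => by rw [hH.eq_left t ht]; ring
  have h₂ : ∀ t, y ≤ t → G t + (H t - d) = H t := fun t ht => by rw [hG.eq_right t ht]; ring
  have hc : ContDiff ℝ ∞ (fun t => G t + (H t - d)) :=
    hG.contDiff.add (hH.contDiff.sub contDiff_const)
  refine ⟨hc, fun t ht => ?_, fun t ht => ?_, fun t hxt htz => ?_, fun t => ?_⟩
  · rw [h₁ t (ht.trans hxy), hG.eq_left t ht]
  · rw [h₂ t (hyz.trans ht), hH.eq_right t ht]
  · rcases le_total t y with h | h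
    · rw [h₁ t h]; exact hG.between t hxt h
    · rw [h₂ t h]; exact hH.between t h htz
  · exact abs_iteratedDeriv_le_of_glue (hc.of_le (by exact_mod_cast le_top))
      (fun s hs => h₁ s hs.le) (fun s hs => h₂ s hs.le) hG.bound hH.bound t

theorem isSmoothBetween_smoothStep {F₁ F₂ R : ℝ → ℝ} {p x y c d B M : ℝ} {m : ℕ} (hm : 1 ≤ m)
    (hmp : m ≤ p) (hF : ∀ x y, F₁ x - F₂ y ≤ |x - y| ^ p) (hR : IsSeparationScale F₁ F₂ R)
    (hx : IsLocalLevel F₁ F₂ R p x c) (hy : IsLocalLevel F₁ F₂ R p y d) (hxy : x < y)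
    (hRy : 0 ≤ R y) (h₁ : R x / 5 ≤ y - x) (h₂ : y - x ≤ R x / 2) (hM : y - x ≤ M)
    (hB : ∀ t, |iteratedDeriv m Real.smoothTransition t| ≤ B) :
    IsSmoothBetween F₁ F₂ m (3 * 55 ^ p * M ^ (p - m) * B) x y c d (smoothStep x (y - x) c d) := by
  have hℓ : 0 < y - x := sub_pos.mpr hxy
  have hp : 0 ≤ p := (Nat.cast_nonneg m).trans hmp
  have hxR : ∀ t, x ≤ t → t ≤ y → |t - x| ≤ R x := fun t h h' => by
    rw [abs_le]; constructor <;> linarith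
  have hyR : ∀ t, x ≤ t → t ≤ y → |t - y| ≤ R y := fun t h h' => by
    have := hR.lipschitz x y
    rw [abs_sub_comm, abs_of_pos hℓ] at this
    rw [abs_le]; constructor <;> linarith
  refine ⟨smoothStep_contDiff .., fun t ht => smoothStep_of_le hℓ ht,
    fun t ht => smoothStep_of_ge hℓ (by linarith), fun t h h' => ?_, fun t => ?_⟩
  · have hx' := hx.between t (hxR t h h')
    have hy' := hy.between t (hyR t h h')
    exact ⟨le_smoothStep hx'.1 hy'.1, smoothStep_le hx'.2 hy'.2⟩
  · have hB0 : 0 ≤ B := (abs_nonneg _).trans (hB 0)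
    have hcd := hx.abs_sub_le hp hF hR hy (by linarith) hRy
      (by rw [abs_sub_comm, abs_of_pos hℓ]; exact h₂)
    rw [iteratedDeriv_smoothStep hm, abs_mul, abs_mul, abs_pow, abs_of_pos (inv_pos.mpr hℓ),
      abs_sub_comm]
    calc |c - d| * ((y - x)⁻¹ ^ m * |iteratedDeriv m Real.smoothTransition ((y - x)⁻¹ * (t - x))|)
        ≤ (3 * (55 * (y - x)) ^ p) * ((y - x)⁻¹ ^ m * B) := by
          refine mul_le_mul (hcd.trans ?_) ?_ (by positivity) (by positivity)
          · gcongr ?_ * ?_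
            exact Real.rpow_le_rpow (by linarith) (by linarith) hp
          · gcongr
            exact hB _
      _ = 3 * 55 ^ p * (y - x) ^ (p - m) * B := by
          rw [Real.mul_rpow (by norm_num) hℓ.le, Real.rpow_sub hℓ, Real.rpow_natCast, inv_pow]
          ring
      _ ≤ _ := by
          gcongr

theorem exists_isSmoothBetween_of_isLocalLevel {F₁ F₂ R : ℝ → ℝ} {p L d δ B M : ℝ} {m : ℕ}
    (hm : 1 ≤ m) (hmp : m ≤ p) (hF : ∀ x y, F₁ x - F₂ y ≤ |x - y| ^ p)
    (hR : IsSeparationScale F₁ F₂ R) (hδ : 0 < δ) (hδR : ∀ x, δ ≤ R x) (hRM : ∀ x, R x ≤ M)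
    (hB : ∀ t, |iteratedDeriv m Real.smoothTransition t| ≤ B)
    (hL : IsLocalLevel F₁ F₂ R p L d) (n : ℕ) :
    ∀ x c, L - x ≤ n * (δ / 4) → R x / 5 ≤ L - x → IsLocalLevel F₁ F₂ R p x c →
      ∃ G, IsSmoothBetween F₁ F₂ m (3 * 55 ^ p * M ^ (p - m) * B) x L c d G := by
  have hp : 0 ≤ p := (Nat.cast_nonneg m).trans hmp
  induction n with
  | zero =>
    intro x c h h'
    have := hδR x
    rw [Nat.cast_zero, zero_mul] at h
    linarith
  | succ n ih =>
    intro x c h h' hx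
    have hRx := hδR x
    have hMx := hRM x
    by_cases hlast : L - x ≤ R x / 2
    · exact ⟨_, isSmoothBetween_smoothStep hm hmp hF hR hx hL (by linarith)
        (hδ.le.trans (hδR L)) h' hlast (by linarith) hB⟩
    · have hRy := hδR (x + R x / 4)
      obtain ⟨e, he⟩ := exists_isLocalLevel hp hF hR (hδ.le.trans hRy)
      have hlip := hR.lipschitz (x + R x / 4) x
      rw [add_sub_cancel_left, abs_of_pos (by linarith)] at hlip
      push_cast at h
      obtain ⟨H, hH⟩ := ih (x + R x / 4) e (by linarith) (by linarith) he
      have hG := isSmoothBetween_smoothStep (M := M) hm hmp hF hR hx he (by linarith)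
        (hδ.le.trans hRy) (by linarith) (by linarith) (by linarith) hB
      exact ⟨_, hG.trans (by linarith) (by linarith) hH⟩

/-- If `F₁ x - F₂ y ≤ |x - y| ^ p` and `F₁` lies strictly below `F₂`, then there is a smooth
periodic function between `F₁` and `F₂` whose derivative of order `m ≤ p` is bounded by a constant. -/
theorem exists_isSmoothBetween {p T : ℝ} {m : ℕ} (hT : 0 < T) (hm : 1 ≤ m) (hmp : m ≤ p) :
    ∃ K, ∀ (F₁ F₂ : ℝ → ℝ) (δ : ℝ), F₁.Periodic T → F₂.Periodic T → 0 < δ →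
      (∀ y z, |y - z| ≤ δ → F₁ y ≤ F₂ z) → (∀ x y, F₁ x - F₂ y ≤ |x - y| ^ p) →
      ∃ G c, IsSmoothBetween F₁ F₂ m K 0 T c c G := by
  obtain ⟨B, hB⟩ := exists_bound_iteratedDeriv_smoothTransition hm
  have hB0 : 0 ≤ B := (abs_nonneg _).trans (hB 0)
  have hp : 0 ≤ p := (Nat.cast_nonneg m).trans hmp
  refine ⟨3 * 55 ^ p * (T / 2) ^ (p - m) * B, fun F₁ F₂ δ h₁ h₂ hδ hsep hF => ?_⟩
  by_cases hab : ∃ a b, F₂ b < F₁ a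
  · obtain ⟨a, b, hab⟩ := hab
    obtain ⟨R, hR, hRT, hRb⟩ := exists_separationScale hT h₁ h₂ hδ hsep hab
    obtain ⟨c, hc⟩ := exists_isLocalLevel hp hF hR (x := 0) (by linarith [hRb 0])
    have hcT : IsLocalLevel F₁ F₂ R p T c := by
      have e : R T = R 0 := by simpa using hRT 0
      refine ⟨fun y hy => ?_, ?_, ?_⟩
      · rw [← h₁.sub_eq y, ← h₂.sub_eq y]
        exact hc.between _ (by rwa [sub_zero, ← e])
      · obtain ⟨u, hu, h⟩ := hc.le_upper
        exact ⟨u + T, by rwa [add_sub_cancel_right, e, ← sub_zero u], by rwa [h₁ u, e]⟩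
      · obtain ⟨u, hu, h⟩ := hc.lower_le
        exact ⟨u + T, by rwa [add_sub_cancel_right, e, ← sub_zero u], by rwa [h₂ u, e]⟩
    obtain ⟨n, hn⟩ := exists_nat_ge (T / (δ / 4 / 4))
    obtain ⟨G, hG⟩ := exists_isSmoothBetween_of_isLocalLevel hm hmp hF hR (δ := δ / 4)
      (by linarith) (fun x => (hRb x).1) (fun x => (hRb x).2) hB hcT n 0 c
      (by rwa [sub_zero, ← div_le_iff₀ (by linarith)]) (by linarith [(hRb 0).2]) hc
    exact ⟨G, c, hG⟩
  · push Not at hab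
    have hbdd : BddAbove (Set.range F₁) := ⟨F₂ 0, by rintro _ ⟨x, rfl⟩; exact hab x 0⟩
    refine ⟨fun _ => sSup (Set.range F₁), sSup (Set.range F₁), contDiff_const, fun _ _ => rfl,
      fun _ _ => rfl, fun t _ _ => ⟨le_csSup hbdd ⟨t, rfl⟩, ?_⟩, fun t => ?_⟩
    · exact csSup_le (Set.range_nonempty F₁) (by rintro _ ⟨x, rfl⟩; exact hab x t)
    · have hm0 : m ≠ 0 := by omega
      simp only [iteratedDeriv_const, hm0, if_false, abs_zero]
      positivity

end Chain

section FourierDecay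

open scoped ContDiff

/-- A smooth function, constant on both sides of `[0, 2π]` with the same value. -/
structure IsFlatOutside (c : ℝ) (G : ℝ → ℝ) : Prop where
  contDiff : ContDiff ℝ ∞ G
  eq_left : ∀ t ≤ 0, G t = c
  eq_right : ∀ t, 2 * π ≤ t → G t = c

theorem IsFlatOutside.contDiff_nat {c : ℝ} {G : ℝ → ℝ} (hG : IsFlatOutside c G) (n : ℕ) :
    ContDiff ℝ n G :=
  hG.contDiff.of_le (by exact_mod_cast le_top)

theorem IsFlatOutside.continuous_iteratedDeriv {c : ℝ} {G : ℝ → ℝ} (hG : IsFlatOutside c G)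
    (j : ℕ) : Continuous (iteratedDeriv j G) :=
  (hG.contDiff_nat j).continuous_iteratedDeriv j le_rfl

theorem IsFlatOutside.iteratedDeriv_endpoints {c : ℝ} {G : ℝ → ℝ} (hG : IsFlatOutside c G)
    (j : ℕ) : iteratedDeriv j G (2 * π) = iteratedDeriv j G 0 := by
  have hc : Continuous (iteratedDeriv j fun _ : ℝ => c) :=
    (contDiff_const (n := j)).continuous_iteratedDeriv j le_rfl
  have h₀ : Set.EqOn (iteratedDeriv j G) (iteratedDeriv j fun _ => c) (Set.Iic 0) := by
    rw [← closure_Iio]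
    refine Set.EqOn.closure ?_ (hG.continuous_iteratedDeriv j) hc
    exact Set.EqOn.iteratedDeriv_of_isOpen (fun t ht => hG.eq_left t (le_of_lt ht)) isOpen_Iio j
  have h₁ : Set.EqOn (iteratedDeriv j G) (iteratedDeriv j fun _ => c) (Set.Ici (2 * π)) := by
    rw [← closure_Ioi]
    refine Set.EqOn.closure ?_ (hG.continuous_iteratedDeriv j) hc
    exact Set.EqOn.iteratedDeriv_of_isOpen (fun t ht => hG.eq_right t (le_of_lt ht)) isOpen_Ioi j
  rw [h₀ (Set.mem_Iic.mpr le_rfl), h₁ (Set.mem_Ici.mpr le_rfl), iteratedDeriv_const,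
    iteratedDeriv_const]

/-- The Fourier coefficients on `[0, 2π]` of the `j`-th derivative. -/
noncomputable def derivCoeff (G : ℝ → ℝ) (j : ℕ) (n : ℤ) : ℂ :=
  fourierCoeffOn (lt_add_of_pos_right (0 : ℝ) Real.two_pi_pos)
    (fun t => ((iteratedDeriv j G t : ℝ) : ℂ)) n

theorem IsFlatOutside.norm_derivCoeff_succ {c : ℝ} {G : ℝ → ℝ} (hG : IsFlatOutside c G) (j : ℕ)
    {n : ℤ} (hn : n ≠ 0) : ‖derivCoeff G (j + 1) n‖ = |(n : ℝ)| * ‖derivCoeff G j n‖ := by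
  have hd : ∀ t, HasDerivAt (fun t => ((iteratedDeriv j G t : ℝ) : ℂ))
      ((iteratedDeriv (j + 1) G t : ℝ) : ℂ) t := fun t => by
    rw [iteratedDeriv_succ]
    exact (((hG.contDiff_nat (j + 1)).differentiable_iteratedDeriv j
      (by exact_mod_cast j.lt_succ_self)) t).hasDerivAt.ofReal_comp
  have h := fourierCoeffOn_of_hasDerivAt (lt_add_of_pos_right (0 : ℝ) Real.two_pi_pos) hn
    (fun t _ => hd t) ((Complex.continuous_ofReal.comp
      (hG.continuous_iteratedDeriv (j + 1))).intervalIntegrable _ _)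
  have he : iteratedDeriv j G (0 + 2 * π) = iteratedDeriv j G 0 := by
    rw [zero_add, hG.iteratedDeriv_endpoints j]
  rw [he, sub_self, mul_zero, zero_sub] at h
  have hn' : |(n : ℝ)| ≠ 0 := by simpa using hn
  change derivCoeff G j n = _ * -(_ * derivCoeff G (j + 1) n) at h
  rw [h]
  simp only [norm_mul, norm_neg, norm_div, norm_one, Complex.norm_I, Complex.norm_intCast,
    Complex.norm_real, Complex.norm_ofNat, sub_zero, Complex.ofReal_mul, Complex.ofReal_ofNat,
    Complex.ofReal_zero, zero_add, Real.norm_eq_abs, abs_of_pos Real.pi_pos]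
  field_simp [Real.pi_pos.ne']

theorem IsFlatOutside.norm_derivCoeff {c : ℝ} {G : ℝ → ℝ} (hG : IsFlatOutside c G) (j : ℕ)
    {n : ℤ} (hn : n ≠ 0) : ‖derivCoeff G j n‖ = |(n : ℝ)| ^ j * ‖derivCoeff G 0 n‖ := by
  induction j with
  | zero => simp
  | succ j ih => rw [hG.norm_derivCoeff_succ j hn, ih, pow_succ]; ring

theorem IsFlatOutside.hasSum_sq_derivCoeff {c : ℝ} {G : ℝ → ℝ} (hG : IsFlatOutside c G) (j : ℕ) :
    HasSum (fun n => ‖derivCoeff G j n‖ ^ 2)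
      ((2 * π)⁻¹ * ∫ t in (0 : ℝ)..2 * π, |iteratedDeriv j G t| ^ 2) := by
  have hcont : Continuous fun t => ((iteratedDeriv j G t : ℝ) : ℂ) :=
    Complex.continuous_ofReal.comp (hG.continuous_iteratedDeriv j)
  have := hasSum_sq_fourierCoeffOn (lt_add_of_pos_right (0 : ℝ) Real.two_pi_pos)
    (f := fun t => ((iteratedDeriv j G t : ℝ) : ℂ)) (by
      obtain ⟨C, hC⟩ := isCompact_Icc.exists_bound_of_continuousOn
        (s := Set.Icc 0 (0 + 2 * π)) hcont.continuousOn
      refine MemLp.of_bound hcont.aestronglyMeasurable C ?_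
      exact (ae_restrict_mem measurableSet_Ioc).mono fun t ht => hC t (Set.Ioc_subset_Icc_self ht))
  have e : (2 * π)⁻¹ * ∫ t in (0 : ℝ)..2 * π, |iteratedDeriv j G t| ^ 2 = (0 + 2 * π - 0)⁻¹ •
      ∫ t in (0 : ℝ)..0 + 2 * π, ‖((iteratedDeriv j G t : ℝ) : ℂ)‖ ^ 2 := by
    simp only [zero_add, sub_zero, smul_eq_mul, Complex.norm_real, Real.norm_eq_abs]
  rw [e]
  exact this

theorem IsFlatOutside.tsum_sq_derivCoeff_le {c K : ℝ} {G : ℝ → ℝ} (hG : IsFlatOutside c G) {j : ℕ}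
    (hK : ∀ t, |iteratedDeriv j G t| ≤ K) :
    ∑' n, ‖derivCoeff G j n‖ₑ ^ (2 : ℝ) ≤ ENNReal.ofReal K ^ (2 : ℝ) := by
  have hK0 : 0 ≤ K := (abs_nonneg _).trans (hK 0)
  have h := hG.hasSum_sq_derivCoeff j
  have e : ∀ n, ‖derivCoeff G j n‖ₑ ^ (2 : ℝ) =
      ENNReal.ofReal (‖derivCoeff G j n‖ ^ 2) := fun n => by
    rw [ENNReal.rpow_ofNat, ENNReal.ofReal_pow (norm_nonneg _), ofReal_norm]
  simp_rw [e]
  rw [← ENNReal.ofReal_tsum_of_nonneg (fun n => by positivity) h.summable, h.tsum_eq,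
    ENNReal.rpow_ofNat, ← ENNReal.ofReal_pow hK0]
  refine ENNReal.ofReal_le_ofReal ?_
  have : ∫ t in (0 : ℝ)..2 * π, |iteratedDeriv j G t| ^ 2 ≤ ∫ t in (0 : ℝ)..2 * π, K ^ 2 := by
    refine intervalIntegral.integral_mono_on Real.two_pi_pos.le
      (((hG.continuous_iteratedDeriv j).abs.pow 2).intervalIntegrable _ _)
      (continuous_const.intervalIntegrable _ _) fun t _ => ?_
    gcongr
    exact hK t
  rw [intervalIntegral.integral_const, smul_eq_mul, sub_zero] at this
  rw [inv_mul_le_iff₀ Real.two_pi_pos]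
  exact this

theorem IsFlatOutside.summable_derivCoeff {c : ℝ} {G : ℝ → ℝ} (hG : IsFlatOutside c G) :
    Summable (derivCoeff G 0) := by
  have h₁ : Summable fun n : ℤ => 1 / (n : ℝ) ^ 2 := Real.summable_one_div_int_pow.mpr one_lt_two
  have h₂ := (hG.hasSum_sq_derivCoeff 1).summable
  have h₃ : Summable fun n : ℤ => if n = 0 then ‖derivCoeff G 0 0‖ else 0 :=
    (hasSum_ite_eq (0 : ℤ) _).summable
  refine Summable.of_norm_bounded ((h₁.add h₂).add h₃) fun n => ?_
  by_cases hn : n = 0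
  · subst hn
    simp only [if_true]
    have : 0 ≤ 1 / ((0 : ℤ) : ℝ) ^ 2 + ‖derivCoeff G 1 0‖ ^ 2 := by positivity
    linarith
  · have h := hG.norm_derivCoeff 1 hn
    have hn' : 0 < |(n : ℝ)| := by simpa using hn
    have e : 1 / (n : ℝ) ^ 2 = (1 / |(n : ℝ)|) ^ 2 := by rw [div_pow, one_pow, sq_abs]
    have e' : ‖derivCoeff G 0 n‖ = 1 / |(n : ℝ)| * ‖derivCoeff G 1 n‖ := by
      rw [h, pow_one]; field_simp
    rw [if_neg hn, add_zero, e, e']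
    nlinarith [two_mul_le_add_sq (1 / |(n : ℝ)|) ‖derivCoeff G 1 n‖,
      sq_nonneg (1 / |(n : ℝ)|), sq_nonneg ‖derivCoeff G 1 n‖]

end FourierDecay

section FourierPairing

theorem fourierCoeffMeasure_eq {μ ν : Measure Torus} [IsFiniteMeasure μ] [IsFiniteMeasure ν]
    {σ : SignedMeasure Torus} (h : ν.toSignedMeasure = μ.toSignedMeasure + σ) (k : ℤ) :
    fourierCoeffMeasure σ k = (1 / (2 * π) : ℝ) •
      (∫ x, (fourier (-k) x : ℂ) ∂ν - ∫ x, (fourier (-k) x : ℂ) ∂μ) := by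
  have hσ : σ = ν.toSignedMeasure - μ.toSignedMeasure := by rw [h, add_sub_cancel_left]
  have hi : ∀ (ρ : Measure Torus) [IsFiniteMeasure ρ],
      ρ.toSignedMeasure.Integrable (fun x : Torus => (fourier (-k) x : ℂ)) := fun ρ _ => by
    rw [VectorMeasure.Integrable, Measure.variation_toSignedMeasure]
    exact (BoundedContinuousFunction.mkOfCompact (fourier (-k))).integrable ρ
  rw [fourierCoeffMeasure, hσ, VectorMeasure.integral_sub_vectorMeasure (hi ν) (hi μ),
    VectorMeasure.integral_toSignedMeasure, VectorMeasure.integral_toSignedMeasure]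

theorem enorm_fourierCoeffMeasure_neg {μ ν : Measure Torus} [IsFiniteMeasure μ] [IsFiniteMeasure ν]
    {σ : SignedMeasure Torus} (h : ν.toSignedMeasure = μ.toSignedMeasure + σ) (k : ℤ) :
    ‖fourierCoeffMeasure σ (-k)‖ₑ = ‖fourierCoeffMeasure σ k‖ₑ := by
  rw [fourierCoeffMeasure_eq h, fourierCoeffMeasure_eq h, enorm_smul, enorm_smul]
  congr 1
  have e : ∀ ρ : Measure Torus, ∫ x, (fourier (-k) x : ℂ) ∂ρ =
      (starRingEnd ℂ) (∫ x, (fourier (- -k) x : ℂ) ∂ρ) := fun ρ => by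
    rw [← integral_conj, neg_neg]
    simp_rw [fourier_neg]
  rw [e, e, ← map_sub, ← ofReal_norm, ← ofReal_norm, RCLike.norm_conj]

theorem hasSum_integral_of_summable_fourierCoeff {g : C(Torus, ℂ)}
    (hg : Summable (fourierCoeff g)) (ρ : Measure Torus) [IsFiniteMeasure ρ] :
    HasSum (fun n => fourierCoeff g n * ∫ x, (fourier n x : ℂ) ∂ρ) (∫ x, g x ∂ρ) := by
  have hi : ∀ n : ℤ, Integrable (fun x : Torus => fourierCoeff g n * (fourier n x : ℂ)) ρ :=
    fun n =>
    ((BoundedContinuousFunction.mkOfCompact (fourier n)).integrable ρ).const_mul _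
  have h := hasSum_integral_of_summable_integral_norm hi (by
    have : ∀ n : ℤ, ∫ x : Torus, ‖fourierCoeff g n * (fourier n x : ℂ)‖ ∂ρ =
        ‖fourierCoeff g n‖ * ρ.real Set.univ := fun n => by
      simp only [norm_mul, fourier_apply, Circle.norm_coe, mul_one, integral_const, smul_eq_mul]
      ring
    simp_rw [this]
    exact hg.norm.mul_right _)
  simp_rw [integral_const_mul] at h
  have e : ∀ x, ∑' n, fourierCoeff g n * (fourier n x : ℂ) = g x := fun x =>
    (has_pointwise_sum_fourier_series_of_summable hg x).tsum_eq
  simpa only [e] using h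

theorem tsum_mul_le_sqrt_mul_sqrt {ι : Type*} (f g : ι → ℝ≥0∞) :
    ∑' i, f i * g i ≤ (∑' i, f i ^ (2 : ℝ)) ^ (1 / 2 : ℝ) * (∑' i, g i ^ (2 : ℝ)) ^ (1 / 2 : ℝ) := by
  let _ : MeasurableSpace ι := ⊤
  have := ENNReal.lintegral_mul_le_Lp_mul_Lq (μ := Measure.count) Real.HolderConjugate.two_two
    (f := f) (g := g) (measurable_from_top).aemeasurable (measurable_from_top).aemeasurable
  simpa only [lintegral_count, Pi.mul_apply] using this

theorem tsum_int_eq_two_mul {f : ℤ → ℝ≥0∞} (h₀ : f 0 = 0) (hf : ∀ n, f (-n) = f n) :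
    ∑' n, f n = 2 * ∑' k : ℕ, f (k + 1) := by
  have h := tsum_of_add_one_of_neg_add_one (f := f) ENNReal.summable ENNReal.summable
  rw [h, h₀, add_zero, two_mul]
  congr 1
  exact tsum_congr fun k => hf _

end FourierPairing

section Assembly

open scoped ContDiff

/-- The function on the torus which agrees with `G` on `[0, 2π]`. -/
noncomputable def IsFlatOutside.toCircle {c : ℝ} {G : ℝ → ℝ} (hG : IsFlatOutside c G) :
    C(Torus, ℝ) where
  toFun := AddCircle.liftIco (2 * π) 0 G
  continuous_toFun := AddCircle.liftIco_zero_continuous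
    (by rw [hG.eq_left 0 le_rfl, hG.eq_right _ le_rfl]) hG.contDiff.continuous.continuousOn

theorem IsFlatOutside.toCircle_coe {c : ℝ} {G : ℝ → ℝ} (hG : IsFlatOutside c G) {t : ℝ}
    (ht : t ∈ Set.Ico 0 (2 * π)) : hG.toCircle (t : Torus) = G t :=
  AddCircle.liftIco_zero_coe_apply ht

theorem exists_mem_Ico_coe_eq (x : Torus) : ∃ t ∈ Set.Ico 0 (2 * π), (t : Torus) = x := by
  obtain ⟨t, ht, h⟩ := (Set.ext_iff.mp (AddCircle.coe_image_Ico_eq (2 * π) 0) x).mpr trivial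
  exact ⟨t, by rwa [zero_add] at ht, h⟩

/-- The complexification of `IsFlatOutside.toCircle`. -/
noncomputable def IsFlatOutside.toComplexCircle {c : ℝ} {G : ℝ → ℝ} (hG : IsFlatOutside c G) :
    C(Torus, ℂ) where
  toFun x := hG.toCircle x

theorem IsFlatOutside.fourierCoeff_toComplexCircle {c : ℝ} {G : ℝ → ℝ} (hG : IsFlatOutside c G) :
    fourierCoeff hG.toComplexCircle = derivCoeff G 0 := by
  ext n
  have e : (hG.toComplexCircle : Torus → ℂ) =
      AddCircle.liftIco (2 * π) 0 fun t => ((iteratedDeriv 0 G t : ℝ) : ℂ) := by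
    ext x
    obtain ⟨t, ht, rfl⟩ := exists_mem_Ico_coe_eq x
    rw [AddCircle.liftIco_zero_coe_apply ht, iteratedDeriv_zero]
    exact congrArg (fun r : ℝ => (r : ℂ)) (hG.toCircle_coe ht)
  rw [e, fourierCoeff_liftIco_eq, derivCoeff]

theorem IsFlatOutside.enorm_integral_sub_le {c K : ℝ} {G : ℝ → ℝ} (hG : IsFlatOutside c G) {m : ℕ}
    (hK : ∀ t, |iteratedDeriv m G t| ≤ K) {μ ν : Measure Torus} [IsFiniteMeasure μ]
    [IsFiniteMeasure ν] {σ : SignedMeasure Torus} (hmass : μ.real Set.univ = ν.real Set.univ)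
    (h : ν.toSignedMeasure = μ.toSignedMeasure + σ) :
    ‖∫ x, hG.toCircle x ∂ν - ∫ x, hG.toCircle x ∂μ‖ₑ ≤ ENNReal.ofReal (2 * π) *
      (ENNReal.ofReal K * (2 * ∑' k : ℕ, ‖fourierCoeffMeasure σ ((k : ℤ) + 1)‖ₑ ^ 2 /
        ((k : ℝ≥0∞) + 1) ^ (2 * (m : ℝ))) ^ (1 / 2 : ℝ)) := by
  set s := fourierCoeffMeasure σ with hs
  have h0 : s 0 = 0 := by
    rw [hs, fourierCoeffMeasure_eq h]
    simp [hmass]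
  have hsum : Summable (fourierCoeff hG.toComplexCircle) := by
    rw [hG.fourierCoeff_toComplexCircle]
    exact hG.summable_derivCoeff
  have hHas := (hasSum_integral_of_summable_fourierCoeff hsum ν).sub
    (hasSum_integral_of_summable_fourierCoeff hsum μ)
  have hreal : ∀ ρ : Measure Torus, ∫ x, hG.toComplexCircle x ∂ρ =
      ((∫ x, hG.toCircle x ∂ρ : ℝ) : ℂ) := fun ρ => integral_ofReal
  have hterm : ∀ n, fourierCoeff hG.toComplexCircle n * ∫ x, (fourier n x : ℂ) ∂ν -
      fourierCoeff hG.toComplexCircle n * ∫ x, (fourier n x : ℂ) ∂μ =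
      ((2 * π : ℝ) : ℂ) * (derivCoeff G 0 n * s (-n)) := fun n => by
    rw [hG.fourierCoeff_toComplexCircle, hs, fourierCoeffMeasure_eq h, neg_neg, Complex.real_smul]
    have : (π : ℂ) ≠ 0 := by exact_mod_cast Real.pi_pos.ne'
    push_cast
    field_simp
  simp_rw [hterm, hreal, ← Complex.ofReal_sub] at hHas
  set b : ℤ → ℝ≥0∞ := fun n => ‖s n‖ₑ / (n.natAbs : ℝ≥0∞) ^ m
  have hb0 : b 0 = 0 := by simp [b, h0]
  have hbneg : ∀ n, b (-n) = b n := fun n => by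
    simp only [b, Int.natAbs_neg, hs, enorm_fourierCoeffMeasure_neg h]
  have hb : ∑' n, b n ^ (2 : ℝ) = 2 * ∑' k : ℕ, ‖s ((k : ℤ) + 1)‖ₑ ^ 2 /
      ((k : ℝ≥0∞) + 1) ^ (2 * (m : ℝ)) := by
    rw [tsum_int_eq_two_mul (by rw [hb0]; simp) (fun n => by rw [hbneg])]
    congr 1
    refine tsum_congr fun k => ?_
    have e : ((k : ℤ) + 1).natAbs = k + 1 := by omega
    simp only [b, e]
    rw [ENNReal.div_rpow_of_nonneg _ _ zero_le_two, ENNReal.rpow_ofNat, mul_comm (2 : ℝ),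
      ENNReal.rpow_mul, ENNReal.rpow_natCast]
    push_cast
    rfl
  have hle : ∀ n, ‖derivCoeff G 0 n * s (-n)‖ₑ ≤ ‖derivCoeff G m n‖ₑ * b n := fun n => by
    rw [← hbneg n]
    by_cases hn : n = 0
    · simp [hn, h0]
    · have hn1 : (n.natAbs : ℝ≥0∞) ^ m ≠ 0 := by simp [hn]
      have hn2 : (n.natAbs : ℝ≥0∞) ^ m ≠ ⊤ := ENNReal.pow_ne_top (ENNReal.natCast_ne_top _)
      have e : ‖derivCoeff G m n‖ₑ = (n.natAbs : ℝ≥0∞) ^ m * ‖derivCoeff G 0 n‖ₑ := by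
        rw [← ofReal_norm, ← ofReal_norm, hG.norm_derivCoeff m hn,
          ENNReal.ofReal_mul (by positivity), ENNReal.ofReal_pow (abs_nonneg _)]
        congr 2
        rw [← ENNReal.ofReal_natCast, Nat.cast_natAbs, Int.cast_abs]
      rw [enorm_mul, e]
      simp only [b, Int.natAbs_neg]
      rw [mul_right_comm, mul_comm, ENNReal.mul_div_cancel hn1 hn2]
  calc ‖∫ x, hG.toCircle x ∂ν - ∫ x, hG.toCircle x ∂μ‖ₑ
      = ‖∑' n, ((2 * π : ℝ) : ℂ) * (derivCoeff G 0 n * s (-n))‖ₑ := by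
        rw [hHas.tsum_eq, ← ofReal_norm, ← ofReal_norm, Complex.norm_real]
    _ = ENNReal.ofReal (2 * π) * ‖∑' n, derivCoeff G 0 n * s (-n)‖ₑ := by
        rw [tsum_mul_left, enorm_mul, ← ofReal_norm, Complex.norm_real,
          Real.norm_of_nonneg Real.two_pi_pos.le]
    _ ≤ ENNReal.ofReal (2 * π) * ∑' n, ‖derivCoeff G m n‖ₑ * b n := by
        gcongr
        exact enorm_tsum_le_tsum_enorm.trans (ENNReal.tsum_le_tsum hle)
    _ ≤ _ := by
        gcongr
        refine (tsum_mul_le_sqrt_mul_sqrt _ _).trans ?_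
        rw [hb]
        gcongr
        refine (ENNReal.rpow_le_rpow (hG.tsum_sq_derivCoeff_le hK) (by norm_num)).trans_eq ?_
        rw [← ENNReal.rpow_mul]
        norm_num

end Assembly

section Main

theorem dist_coe_le_abs_sub (x y : ℝ) : dist (x : Torus) (y : Torus) ≤ |x - y| := by
  rw [dist_eq_norm, ← AddCircle.coe_sub]
  exact QuotientAddGroup.norm_mk_le_norm

/-- The dual Kantorovich functional is bounded by the negative Sobolev norm of order `m` of the
difference of the measures, for an integer `m ≤ p`. -/
theorem exists_dual_le {p : ℝ} {m : ℕ} (hm : 1 ≤ m) (hmp : m ≤ p) :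
    ∃ K : ℝ, ∀ (μ ν : Measure Torus) [IsFiniteMeasure μ] [IsFiniteMeasure ν]
      (σ : SignedMeasure Torus),
      μ.real Set.univ = ν.real Set.univ → ν.toSignedMeasure = μ.toSignedMeasure + σ →
      ∀ E : ℝ≥0∞, E ≠ ∞ → ENNReal.ofReal (2 * π) *
        (ENNReal.ofReal K * (2 * ∑' k : ℕ, ‖fourierCoeffMeasure σ ((k : ℤ) + 1)‖ₑ ^ 2 /
          ((k : ℝ≥0∞) + 1) ^ (2 * (m : ℝ))) ^ (1 / 2 : ℝ)) ≤ E →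
      ∀ φ ψ : C(Torus, ℝ), (∀ x y, φ x + ψ y ≤ dist x y ^ p) →
        ∫ x, φ x ∂μ + ∫ y, ψ y ∂ν ≤ E.toReal := by
  have hp : 0 < p := lt_of_lt_of_le (by exact_mod_cast hm) hmp
  obtain ⟨K, hK⟩ := exists_isSmoothBetween Real.two_pi_pos hm hmp
  refine ⟨K, fun μ ν _ _ σ hmass h E hE hEle φ ψ hφψ => le_of_forall_pos_le_add fun ε' hε' => ?_⟩
  set ε := ε' / (ν.real Set.univ + 1)
  have hε : 0 < ε := by positivity
  have hφψ' : ∀ x y : ℝ, φ x + ψ y ≤ |x - y| ^ p := fun x y =>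
    (hφψ x y).trans (Real.rpow_le_rpow dist_nonneg (dist_coe_le_abs_sub x y) hp.le)
  obtain ⟨G, c, hG⟩ := hK (fun t => φ t) (fun t => ε - ψ t) (ε ^ p⁻¹)
    (fun t => by simp) (fun t => by simp) (by positivity)
    (fun y z hyz => by
      have h1 := (hφψ' y z).trans (Real.rpow_le_rpow (abs_nonneg _) hyz hp.le)
      rw [Real.rpow_inv_rpow hε.le hp.ne'] at h1
      linarith)
    (fun x y => by linarith [hφψ' x y])
  have hflat : IsFlatOutside c G := ⟨hG.contDiff, hG.eq_left, hG.eq_right⟩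
  have hφg : ∀ x, φ x ≤ hflat.toCircle x ∧ hflat.toCircle x ≤ ε - ψ x := fun x => by
    obtain ⟨t, ht, rfl⟩ := exists_mem_Ico_coe_eq x
    rw [hflat.toCircle_coe ht]
    exact hG.between t ht.1 ht.2.le
  have h1 : ∫ x, φ x ∂μ ≤ ∫ x, hflat.toCircle x ∂μ :=
    integral_mono (integrable_continuousMap μ _) (integrable_continuousMap μ _) fun x => (hφg x).1
  have h2 : ∫ x, hflat.toCircle x ∂ν ≤ ∫ x, (ε - ψ x) ∂ν :=
    integral_mono (integrable_continuousMap ν _)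
      ((integrable_const ε).sub (integrable_continuousMap ν ψ)) fun x => (hφg x).2
  rw [integral_sub (integrable_const ε) (integrable_continuousMap ν ψ), integral_const,
    smul_eq_mul] at h2
  have h3 : |∫ x, hflat.toCircle x ∂ν - ∫ x, hflat.toCircle x ∂μ| ≤ E.toReal := by
    have := ENNReal.toReal_mono hE ((hflat.enorm_integral_sub_le hG.bound hmass h).trans hEle)
    rwa [toReal_enorm, Real.norm_eq_abs] at this
  have h4 : ν.real Set.univ * ε ≤ ε' := by
    have : (ν.real Set.univ + 1) * ε = ε' := mul_div_cancel₀ _ (by positivity)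
    linarith
  linarith [(abs_le.mp h3).1]

/-- A bound for the dual Kantorovich functional bounds the transport cost. -/
theorem iInf_couplings_le {p : ℝ} (hp : 0 ≤ p) (μ ν : Measure Torus) [IsFiniteMeasure μ]
    [IsFiniteMeasure ν] (hmass : μ.real Set.univ = ν.real Set.univ) {E : ℝ≥0∞} (hE : E ≠ ∞)
    (h : ∀ φ ψ : C(Torus, ℝ), (∀ x y, φ x + ψ y ≤ dist x y ^ p) →
      ∫ x, φ x ∂μ + ∫ y, ψ y ∂ν ≤ E.toReal) :
    ⨅ γ ∈ couplings μ ν, ∫⁻ z, edist z.1 z.2 ^ p ∂γ ≤ E := by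
  let c : C(Torus × Torus, ℝ) :=
    ⟨fun z => dist z.1 z.2 ^ p, continuous_dist.rpow_const fun _ => Or.inr hp⟩
  obtain ⟨γ, hγ, hfin, hle⟩ := exists_coupling_integral_le μ ν hmass c E.toReal h
  refine (iInf₂_le γ hγ).trans ?_
  have e : ∀ z : Torus × Torus, edist z.1 z.2 ^ p = ENNReal.ofReal (c z) := fun z => by
    rw [edist_dist, ENNReal.ofReal_rpow_of_nonneg dist_nonneg hp]
    rfl
  simp_rw [e]
  rw [← ofReal_integral_eq_lintegral_ofReal (integrable_continuousMap γ c)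
    (Filter.Eventually.of_forall fun z => Real.rpow_nonneg dist_nonneg p)]
  exact (ENNReal.ofReal_le_ofReal hle).trans (ENNReal.ofReal_toReal hE).le

end Main

end TorusTransport

/-- For every `p ∈ [1, ∞)` there is a constant `C`, depending only on `p`, such that
`W_p(μ, μ + σ) ≤ C (∑_{k ≥ 1} |σ̂(k)|² / k^(2p-2)) ^ (1 / 2p)` for every absolutely continuous
finite measure `μ` on the torus and every finite signed measure `σ` of total mass zero such that
`ν = μ + σ` is again a (nonnegative) measure. -/
theorem theorem1 (p : ℝ) (hp : 1 ≤ p) :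
    ∃ C : ℝ≥0, ∀ (μ ν : Measure TorusTransport.Torus) [IsFiniteMeasure μ] [IsFiniteMeasure ν]
      (σ : SignedMeasure TorusTransport.Torus),
      μ ≪ volume →
      σ Set.univ = 0 →
      ν.toSignedMeasure = μ.toSignedMeasure + σ →
      TorusTransport.wasserstein p μ ν ≤
        C * (∑' k : ℕ, ‖TorusTransport.fourierCoeffMeasure σ ((k : ℤ) + 1)‖ₑ ^ 2 /
          ((k : ℝ≥0∞) + 1) ^ (2 * p - 2)) ^ (1 / (2 * p)) := by
  have hp0 : 0 < p := by linarith
  have hm : 1 ≤ ⌊p⌋₊ := Nat.le_floor (by exact_mod_cast hp)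
  have hmp : (⌊p⌋₊ : ℝ) ≤ p := Nat.floor_le hp0.le
  have hpm : p < ⌊p⌋₊ + 1 := Nat.lt_floor_add_one p
  obtain ⟨K, hK⟩ := TorusTransport.exists_dual_le hm hmp
  let C₀ : ℝ≥0 := (2 * π).toNNReal * (K.toNNReal * 2 ^ (1 / 2 : ℝ))
  refine ⟨C₀ ^ (1 / p), fun μ ν _ _ σ _ hσ h => ?_⟩
  have hmass : μ.real Set.univ = ν.real Set.univ := by
    have := congrArg (fun τ : SignedMeasure TorusTransport.Torus => τ Set.univ) h
    simpa [Measure.toSignedMeasure_apply_measurable, hσ] using this.symm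
  set S := ∑' k : ℕ, ‖TorusTransport.fourierCoeffMeasure σ ((k : ℤ) + 1)‖ₑ ^ 2 /
    ((k : ℝ≥0∞) + 1) ^ (2 * p - 2)
  have hSm : ∑' k : ℕ, ‖TorusTransport.fourierCoeffMeasure σ ((k : ℤ) + 1)‖ₑ ^ 2 /
      ((k : ℝ≥0∞) + 1) ^ (2 * (⌊p⌋₊ : ℝ)) ≤ S :=
    ENNReal.tsum_le_tsum fun k => ENNReal.div_le_div_left
      (ENNReal.rpow_le_rpow_of_exponent_le le_add_self (by linarith)) _
  have hE : ENNReal.ofReal (2 * π) * (ENNReal.ofReal K *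
      (2 * ∑' k : ℕ, ‖TorusTransport.fourierCoeffMeasure σ ((k : ℤ) + 1)‖ₑ ^ 2 /
        ((k : ℝ≥0∞) + 1) ^ (2 * (⌊p⌋₊ : ℝ))) ^ (1 / 2 : ℝ)) ≤ C₀ * S ^ (1 / 2 : ℝ) := by
    have e : (C₀ : ℝ≥0∞) * S ^ (1 / 2 : ℝ) = ENNReal.ofReal (2 * π) *
        (ENNReal.ofReal K * (2 * S) ^ (1 / 2 : ℝ)) := by
      rw [ENNReal.mul_rpow_of_nonneg _ _ (by norm_num)]
      simp only [C₀, ENNReal.coe_mul, ENNReal.ofReal,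
        ENNReal.coe_rpow_of_nonneg _ (show (0 : ℝ) ≤ 1 / 2 by norm_num), ENNReal.coe_ofNat]
      ring
    rw [e]
    gcongr
  have hcost : ⨅ γ ∈ TorusTransport.couplings μ ν, ∫⁻ z, edist z.1 z.2 ^ p ∂γ ≤
      C₀ * S ^ (1 / 2 : ℝ) := by
    by_cases htop : (C₀ : ℝ≥0∞) * S ^ (1 / 2 : ℝ) = ∞
    · rw [htop]
      exact le_top
    · exact TorusTransport.iInf_couplings_le hp0.le μ ν hmass htop (hK μ ν σ hmass h _ htop hE)
  refine (ENNReal.rpow_le_rpow hcost (by positivity)).trans_eq ?_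
  rw [ENNReal.mul_rpow_of_nonneg _ _ (by positivity), ← ENNReal.rpow_mul,
    ENNReal.coe_rpow_of_nonneg _ (by positivity)]
  congr 2
  field_simp
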